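/- Let $2<n<\omega$. A cylindric algebra of dimension $\alpha$ (a $\mathsf{CA}_\alpha$) is a Boolean algebra with unary operations $\mathsf c_i$ and constants $\mathsf d_{ij}$ ($i,j<\alpha$) such that, for all $i,j,k<\alpha$ and all elements $x,y$: $\mathsf c_i0=0$; $x\le \mathsf c_ix$; $\mathsf c_i(x\cdot \mathsf c_iy)=\mathsf c_ix\cdot\mathsf c_iy$; $\mathsf c_i\mathsf c_jx=\mathsf c_j\mathsf c_ix$; $\mathsf d_{ii}=1$; $\mathsf d_{ij}=\mathsf c_k(\mathsf d_{ik}\cdot \mathsf d_{kj})$ if $k\ne i,j$; and $\mathsf c_i(\mathsf d_{ij}\cdot x)\cdot \mathsf c_i(\mathsf d_{ij}\cdot -x)=0$ if $i\neq j$. For $n\le\beta$ and $\mathfrak D\in\mathsf{CA}_\beta$, the neat $n$-reduct $\mathfrak{Nr}_n\mathfrak D\in\mathsf{CA}_n$ has as elements those $a\in\mathfrak D$ with $\mathsf c_ia=a$ for all $n\le i<\beta$, and the operations of $\mathfrak D$ with indices below $n$. Let $\mathsf{Nr}_n\mathsf{CA}_\beta$ be the class of algebras isomorphic to some $\mathfrak{Nr}_n\mathfrak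 D$ with $\mathfrak D\in\mathsf{CA}_\beta$. For a class $\mathsf L$ of $\mathsf{CA}_n$s, let $\mathbf S_d\mathsf L$ be the class of algebras isomorphic to a subalgebra $\mathfrak A$ of some $\mathfrak C\in\mathsf L$ that is dense in $\mathfrak C$, i.e. every nonzero element of $\mathfrak C$ is above a nonzero element of $\mathfrak A$. A class of $\mathsf{CA}_n$s is elementary if it is the class of all models of some set of first-order sentences in the language of $\mathsf{CA}_n$s. Theorem. No class $\mathbf K$ with $\mathsf{Nr}_n\mathsf{CA}_\omega\subseteq\mathbf K\subseteq\mathbf S_d\mathsf{Nr}_n\mathsf{CA}_{n+1}$ is elementary. In fact, there are atomic algebras $\mathfrak A,\mathfrak B\in\mathsf{CA}_n$ such that $\mathfrak A\in\mathsf{Nr}_n\mathsf{CA}_\omega$, $\mathfrak A$ and $\mathfrak B$ are elementarily equivalent, and $\mathfrak B\notin\mathbf S_d\mathsf{Nr}_n\mathsf{CA}_{n+1}$. -/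

import Mathlib

open FirstOrder FirstOrder.Language

universe u

/-- A cylindric algebra whose dimensions are indexed by `I`: a Boolean algebra with
cylindrifications `cyl i` and diagonal elements `diag i j` (`i j : I`) satisfying the usual axioms.
A `CA_n` is the case `I = Fin n`, a `CA_ω` is the case `I = ℕ`. -/
class CylindricAlgebra (I : Type) (A : Type u) extends BooleanAlgebra A where
  cyl : I → A → A
  diag : I → I → A
  cyl_bot : ∀ i, cyl i ⊥ = ⊥
  le_cyl : ∀ i x, x ≤ cyl i x
  cyl_inf_cyl : ∀ i x y, cyl i (x ⊓ cyl i y) = cyl i x ⊓ cyl i y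
  cyl_comm : ∀ i j x, cyl i (cyl j x) = cyl j (cyl i x)
  diag_self : ∀ i, diag i i = ⊤
  diag_eq : ∀ i j k, k ≠ i → k ≠ j → diag i j = cyl k (diag i k ⊓ diag k j)
  cyl_diag_inf : ∀ i j x, i ≠ j → cyl i (diag i j ⊓ x) ⊓ cyl i (diag i j ⊓ xᶜ) = ⊥

namespace CylindricAlgebra

/-- The operation symbols of cylindric algebras of dimension `I`, by arity. -/
inductive Func (I : Type) : ℕ → Type
  | sup : Func I 2
  | inf : Func I 2
  | compl : Func I 1
  | bot : Func I 0
  | top : Func I 0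
  | cyl (i : I) : Func I 1
  | diag (i j : I) : Func I 0

/-- The first-order language of cylindric algebras of dimension `I` (equality being logical). -/
def lang (I : Type) : FirstOrder.Language := ⟨Func I, fun _ => Empty⟩

/-- A cylindric algebra as a first-order structure. -/
instance structureOf (I : Type) (A : Type u) [CylindricAlgebra I A] : (lang I).Structure A where
  funMap := fun {m} (f : Func I m) =>
    match m, f with
    | _, .sup => fun v => v 0 ⊔ v 1
    | _, .inf => fun v => v 0 ⊓ v 1
    | _, .compl => fun v => (v 0)ᶜ
    | _, .bot => fun _ => ⊥
    | _, .top => fun _ => ⊤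
    | _, .cyl i => fun v => cyl i (v 0)
    | _, .diag i j => fun _ => diag i j
  RelMap := fun {_} (r : Empty) => r.elim

section Basic

variable {J : Type} {D : Type u} [CylindricAlgebra J D]

theorem cyl_cyl (j : J) (x : D) : cyl j (cyl j x) = cyl j x := by
  have h := cyl_inf_cyl j (⊤ : D) x
  have ht : cyl j (⊤ : D) = ⊤ := top_le_iff.1 (le_cyl j ⊤)
  rwa [ht, top_inf_eq] at h

theorem cyl_inf_of_fixed {j : J} {x y : D} (hx : cyl j x = x) (hy : cyl j y = y) :
    cyl j (x ⊓ y) = x ⊓ y := by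
  have h := cyl_inf_cyl j x y
  rwa [hx, hy] at h

theorem cyl_compl_of_fixed {j : J} {x : D} (hx : cyl j x = x) : cyl j xᶜ = xᶜ := by
  have h := cyl_inf_cyl j xᶜ x
  rw [hx, compl_inf_eq_bot, cyl_bot] at h
  exact le_antisymm (le_compl_iff_disjoint_right.2 (disjoint_iff.2 h.symm)) (le_cyl j _)

theorem cyl_sup_of_fixed {j : J} {x y : D} (hx : cyl j x = x) (hy : cyl j y = y) :
    cyl j (x ⊔ y) = x ⊔ y := by
  have h := cyl_compl_of_fixed (cyl_inf_of_fixed (cyl_compl_of_fixed hx) (cyl_compl_of_fixed hy))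
  simpa using h

theorem cyl_diag_of_ne {i j k : J} (hi : k ≠ i) (hj : k ≠ j) :
    cyl k (diag i j : D) = diag i j := by
  rw [diag_eq i j k hi hj, cyl_cyl]

end Basic

variable {I J : Type}

/-- The Boolean subalgebra of those `a` whose dimension set `{j | cyl j a ≠ a}` is contained in the
image of `I` under `e : I ↪ J`. -/
def neatSubalgebra (e : I ↪ J) (D : Type u) [CylindricAlgebra J D] : BooleanSubalgebra D where
  carrier := {a | ∀ j, cyl j a ≠ a → j ∈ Set.range e}
  supClosed' := fun x hx y hy j h => by
    by_contra hj
    exact h (cyl_sup_of_fixed (not_not.1 (mt (hx j) hj)) (not_not.1 (mt (hy j) hj)))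
  infClosed' := fun x hx y hy j h => by
    by_contra hj
    exact h (cyl_inf_of_fixed (not_not.1 (mt (hx j) hj)) (not_not.1 (mt (hy j) hj)))
  compl_mem' := fun {x} hx j h => by
    by_contra hj
    exact h (cyl_compl_of_fixed (not_not.1 (mt (hx j) hj)))
  bot_mem' := fun j h => (h (cyl_bot j)).elim

/-- The neat reduct of `D`: its elements are those of `neatSubalgebra e D`, its operations are
those of `D` with the cylindrifications and diagonals outside the image of `e` discarded. -/
instance neatReduct (e : I ↪ J) (D : Type u) [CylindricAlgebra J D] :
    CylindricAlgebra I (neatSubalgebra e D) where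
  cyl i a := ⟨cyl (e i) (a : D), fun j h => a.2 j fun ha => h (by rw [cyl_comm, ha])⟩
  diag i k := ⟨diag (e i) (e k), fun j h => by
    by_contra hj
    exact h (cyl_diag_of_ne (fun h' => hj ⟨i, h'.symm⟩) (fun h' => hj ⟨k, h'.symm⟩))⟩
  cyl_bot _ := Subtype.ext (cyl_bot _)
  le_cyl _ _ := Subtype.coe_le_coe.1 (le_cyl _ _)
  cyl_inf_cyl _ _ _ := Subtype.ext (cyl_inf_cyl _ _ _)
  cyl_comm _ _ _ := Subtype.ext (cyl_comm _ _ _)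
  diag_self _ := Subtype.ext (diag_self _)
  diag_eq _ _ _ hi hj := Subtype.ext (diag_eq _ _ _ (e.injective.ne hi) (e.injective.ne hj))
  cyl_diag_inf _ _ _ h := Subtype.ext (cyl_diag_inf _ _ _ (e.injective.ne h))

end CylindricAlgebra

open CylindricAlgebra

/-- The class of all cylindric algebras of dimension `I`. -/
structure CylAlg (I : Type) : Type (u + 1) where
  carrier : Type u
  [inst : CylindricAlgebra I carrier]

attribute [instance] CylAlg.inst

instance CylAlg.coeSort (I : Type) : CoeSort (CylAlg.{u} I) (Type u) := ⟨CylAlg.carrier⟩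

/-- The class of (isomorphic copies of) neat reducts, along `e : I ↪ J`, of cylindric algebras of
dimension `J`. -/
def NeatReducts {I J : Type} (e : I ↪ J) : Set (CylAlg.{u} I) :=
  {A | ∃ D : CylAlg.{u} J, Nonempty (A ≃[lang I] neatSubalgebra e D)}

/-- `Nr_n CA_ω`. -/
def NrOmega (n : ℕ) : Set (CylAlg.{u} (Fin n)) := NeatReducts (J := ℕ) Fin.valEmbedding

/-- `Nr_n CA_{n+1}`. -/
def NrSucc (n : ℕ) : Set (CylAlg.{u} (Fin n)) := NeatReducts (J := Fin (n + 1)) Fin.castSuccEmb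

/-- `S_d K`: the class of (isomorphic copies of) subalgebras `A` of members `C` of `K` that are
dense in `C`, that is, every nonzero element of `C` is above a nonzero element of `A`. -/
def DenseSubalgebras {I : Type} (K : Set (CylAlg.{u} I)) : Set (CylAlg.{u} I) :=
  {A | ∃ C ∈ K, ∃ f : A ↪[lang I] C, ∀ c : C, c ≠ ⊥ → ∃ a : A, a ≠ ⊥ ∧ f a ≤ c}

/-- A class of cylindric algebras of dimension `I` is elementary if it consists of the cylindric
algebras that are models of some set of first-order sentences. (The axioms of cylindric algebras
are themselves first-order, so this is axiomatizability among all structures.) -/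
def IsElementaryClass {I : Type} (K : Set (CylAlg.{u} I)) : Prop :=
  ∃ T : (lang I).Theory, ∀ A : CylAlg.{u} I, A ∈ K ↔ A ⊨ T

/-!
The algebras come from a generic model. Its points carry one of `n` labels, and its finite sets of
points carry colours from an uncountable set `K`, so that over finitely many points every one-point
extension is realised (`Point.exists_extension`). The algebra `A` consists of the sets of
`n`-sequences of points that are invariant under all similarities fixing some finite set of colours;
a similarity preserves labels and equalities, and preserves up to a permutation of `K` the colours
of the sets in which each label occurs exactly once. The extension property gives the
back-and-forth property `SimilarOn.exists_update`, by which such invariant sets are closed under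
cylindrification, in any dimension. Hence the finitely supported sets of infinite sequences form a
cylindric algebra of dimension `ω`, and `A` is its neat reduct (`supportedAlgebra_mem_nrOmega`).

For a permutation `u` of the labels, the part of `A` below the box of sequences labelled by `u` is
the finite-cofinite algebra on `K`: the colour is the only invariant. The algebra `B` is obtained by
admitting, on the box of the identity only, just the sets that are finite or cofinite over a
countable infinite set `K₀` of colours. Proper subsequences do not carry colours, so permuting the
colours on the identity box, and nowhere else, is an automorphism of `A` (`recolourIso`). Finitely
many elements of `B` can be fixed while a given element of `A` is moved into `B`, so `B` is an
elementary subalgebra of `A` by the Tarski–Vaught test (`fewColours_elementarilyEquivalent`).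

If `B` were dense in the neat reduct of an algebra of dimension `n + 1`, the spare dimension would
provide the substitution operator `swapSubst` interchanging the coordinates `0` and `1`. It
preserves disjointness and maps nonzero elements of the neat reduct to nonzero ones, and it maps
the box of the transposition of `0` and `1` into the box of the identity. By density, the uncountably
many colour classes in the former would lead to uncountably many disjoint nonzero elements of `B` in
the latter, each containing a colour from `K₀`
(`fewColours_not_mem_denseSubalgebras`). Since `A` lies in every class between the two of the theorem
and `B` in none, no such class is elementary.
-/

/-! ### Coloured points -/

/-- The points of the generic model. A point carries a label `p : N` and prescribes, by `f`, colours
in `K` for sets of earlier points; the finitely many points it refers to are enumerated by `l`. -/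
inductive Point (N : Type) (K : Type u) : Type u
  | mk (p : N) (m : ℕ) (l : Fin m → Point N K) (f : Set (Fin m) → K) : Point N K

namespace Point

variable {N : Type} {K : Type u}

/-- The label of a point. -/
def label : Point N K → N
  | mk p _ _ _ => p

/-- The set of points to which a point refers. -/
def base : Point N K → Set (Point N K)
  | mk _ _ l _ => Set.range l

/-- The colour which a point prescribes for a set of points; only the part of the set inside the
base of the point matters. -/
def dye : Point N K → Set (Point N K) → K
  | mk _ _ l f, S => f (l ⁻¹' S)

theorem not_mem_base_of_mem_base (a : Point N K) : ∀ b ∈ a.base, a ∉ b.base := by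
  induction a with
  | mk p m l f ih =>
    rintro b ⟨i, rfl⟩ h
    exact ih i _ h ⟨i, rfl⟩

variable [Nonempty K]

open Classical in
/-- The colour of a set of points. It is prescribed by the point of the set whose base contains all
the others; there is at most one such point, and sets without one get a default colour. -/
noncomputable def colour (S : Set (Point N K)) : K :=
  if h : ∃ z ∈ S, S \ {z} ⊆ z.base then h.choose.dye S else Classical.arbitrary K

theorem colour_eq_dye {S : Set (Point N K)} {z : Point N K} (hz : z ∈ S) (h : S \ {z} ⊆ z.base) :
    colour S = z.dye S := by
  have hex : ∃ z ∈ S, S \ {z} ⊆ z.base := ⟨z, hz, h⟩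
  rw [colour, dif_pos hex]
  obtain ⟨h1, h2⟩ := hex.choose_spec
  by_contra hne
  have hne' : hex.choose ≠ z := fun h => hne (by rw [h])
  exact not_mem_base_of_mem_base z _ (h ⟨h1, hne'⟩) (h2 ⟨hz, hne'.symm⟩)

/-- The extension property of the model: over a finite set of points there is a new point with a
given label, giving prescribed colours to the sets consisting of itself and old points. -/
theorem exists_extension {S : Set (Point N K)} (hS : S.Finite) (p : N)
    (g : Set (Point N K) → K) :
    ∃ z ∉ S, z.label = p ∧ ∀ T ⊆ S, colour (insert z T) = g T := by
  obtain ⟨m, l, rfl⟩ := hS.fin_embedding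
  let z : Point N K := mk p m l fun U => g (l '' U)
  have hz : z ∉ Set.range l := fun h => not_mem_base_of_mem_base z z h h
  refine ⟨z, hz, rfl, fun T hT => ?_⟩
  rw [colour_eq_dye (Set.mem_insert z T) fun y hy => hT (hy.1.resolve_left hy.2)]
  change g (l '' (l ⁻¹' (insert z T))) = g T
  rw [Set.image_preimage_eq_inter_range, Set.insert_inter_of_notMem hz,
    Set.inter_eq_left.2 hT]

end Point

/-! ### Similarity of sequences of points -/

section Similarity

open Point Set

variable {I N : Type} {K : Type u} [Nonempty K]

/-- Two sequences of points are similar on the index set `J` over the set `F` of colours if on `J`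
they have the same labels and the same equalities and, up to a permutation of the colours which
fixes those in `F`, corresponding sets in which each label occurs exactly once have the same
colour. -/
def SimilarOn (J : Set I) (F : Set K) (x y : I → Point N K) : Prop :=
  (∀ i ∈ J, (x i).label = (y i).label) ∧ (∀ i ∈ J, ∀ j ∈ J, x i = x j ↔ y i = y j) ∧
    ∃ σ : Equiv.Perm K, (∀ k ∈ F, σ k = k) ∧
      ∀ T ⊆ J, BijOn (fun i => (x i).label) T univ → colour (y '' T) = σ (colour (x '' T))

namespace SimilarOn

variable {J J' : Set I} {F F' : Set K} {x y z : I → Point N K}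

theorem refl (J : Set I) (F : Set K) (x : I → Point N K) : SimilarOn J F x x :=
  ⟨fun _ _ => rfl, fun _ _ _ _ => Iff.rfl, 1, fun _ _ => rfl, fun _ _ _ => rfl⟩

theorem symm (h : SimilarOn J F x y) : SimilarOn J F y x := by
  obtain ⟨hl, he, σ, hσ, hc⟩ := h
  refine ⟨fun i hi => (hl i hi).symm, fun i hi j hj => (he i hi j hj).symm, σ⁻¹,
    fun k hk => Equiv.Perm.inv_eq_iff_eq.2 (hσ k hk).symm, fun T hT hb => ?_⟩
  rw [hc T hT (hb.congr fun i hi => (hl i (hT hi)).symm)]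
  exact (σ.symm_apply_apply _).symm

theorem trans (h : SimilarOn J F x y) (h' : SimilarOn J F y z) : SimilarOn J F x z := by
  obtain ⟨hl, he, σ, hσ, hc⟩ := h
  obtain ⟨hl', he', σ', hσ', hc'⟩ := h'
  refine ⟨fun i hi => (hl i hi).trans (hl' i hi),
    fun i hi j hj => (he i hi j hj).trans (he' i hi j hj), σ' * σ,
    fun k hk => by rw [Equiv.Perm.mul_apply, hσ k hk, hσ' k hk], fun T hT hb => ?_⟩
  rw [hc' T hT (hb.congr fun i hi => hl i (hT hi)), hc T hT hb, Equiv.Perm.mul_apply]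

theorem of_eqOn (h : EqOn x y J) : SimilarOn J F x y :=
  ⟨fun i hi => congrArg label (h hi), fun i hi j hj => by rw [h hi, h hj], 1, fun _ _ => rfl,
    fun _ hT _ => congrArg colour (image_congr fun _ hi => (h (hT hi)).symm)⟩

theorem mono (hJ : J' ⊆ J) (hF : F' ⊆ F) (h : SimilarOn J F x y) : SimilarOn J' F' x y := by
  obtain ⟨hl, he, σ, hσ, hc⟩ := h
  exact ⟨fun i hi => hl i (hJ hi), fun i hi j hj => he i (hJ hi) j (hJ hj), σ,
    fun k hk => hσ k (hF hk), fun T hT => hc T (hT.trans hJ)⟩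

theorem comp {I' : Type} {J' : Set I'} (c : I' → I) (hJ : MapsTo c J' J) (h : SimilarOn J F x y) :
    SimilarOn J' F (x ∘ c) (y ∘ c) := by
  obtain ⟨hl, he, σ, hσ, hc⟩ := h
  refine ⟨fun i hi => hl _ (hJ hi), fun i hi j hj => he _ (hJ hi) _ (hJ hj), σ, hσ,
    fun T hT hb => ?_⟩
  rw [image_comp, image_comp]
  refine hc _ (image_subset_iff.2 fun i hi => hJ (hT hi)) ⟨mapsTo_univ _ _, ?_, ?_⟩
  · rintro _ ⟨i, hi, rfl⟩ _ ⟨j, hj, rfl⟩ hij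
    rw [hb.injOn hi hj hij]
  · intro p _
    obtain ⟨i, hi, hp⟩ := hb.surjOn (mem_univ p)
    exact ⟨c i, mem_image_of_mem c hi, hp⟩

/-- The back-and-forth property of similarity. -/
theorem exists_update [DecidableEq I] {i : I} (hJ : J.Finite) (h : SimilarOn (J \ {i}) F x y)
    (a : Point N K) :
    ∃ b, SimilarOn J F (Function.update x i a) (Function.update y i b) := by
  by_cases ha : ∃ j ∈ J \ {i}, x j = a
  · obtain ⟨j, hj, rfl⟩ := ha
    have hu : ∀ w : I → Point N K, Function.update w i (w j) = w ∘ Function.update id i j :=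
      fun w => by rw [Function.comp_update, Function.comp_id]
    refine ⟨y j, ?_⟩
    rw [hu, hu]
    refine h.comp _ fun k hk => ?_
    by_cases hki : k = i
    · subst hki
      simpa using hj
    · rw [Function.update_of_ne hki]
      exact ⟨hk, hki⟩
  push Not at ha
  obtain ⟨hl, he, σ, hσ, hc⟩ := h
  -- The new point takes, relative to `y`, the `σ`-images of the colours that `a` has relative to
  -- `x`. This is well defined since `x` and `y` have the same equalities.
  obtain ⟨b, hb, hbl, hbc⟩ := exists_extension ((hJ.subset (sdiff_subset (t := {i}))).image y)
    a.label fun T => σ (colour (insert a (x '' {j ∈ J \ {i} | y j ∈ T})))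
  have hb' : ∀ j ∈ J \ {i}, y j ≠ b := fun j hj h => hb ⟨j, hj, h⟩
  have hx : ∀ j ∈ J \ {i}, Function.update x i a j = x j :=
    fun j hj => Function.update_of_ne hj.2 _ _
  have hy : ∀ j ∈ J \ {i}, Function.update y i b j = y j :=
    fun j hj => Function.update_of_ne hj.2 _ _
  have split : ∀ j ∈ J, j = i ∨ j ∈ J \ {i} := fun j hj => (em (j = i)).imp_right fun h => ⟨hj, h⟩
  refine ⟨b, fun j hj => ?_, fun j hj k hk => ?_, σ, hσ, fun T hT hbij => ?_⟩
  · rcases split j hj with rfl | hj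
    · simp [hbl]
    · rw [hx j hj, hy j hj, hl j hj]
  · rcases split j hj with rfl | hj <;> rcases split k hk with rfl | hk
    · simp
    · rw [hx k hk, hy k hk]
      simpa using iff_of_false (ha k hk).symm (hb' k hk).symm
    · rw [hx j hj, hy j hj]
      simpa using iff_of_false (ha j hj) (hb' j hj)
    · rw [hx j hj, hy j hj, hx k hk, hy k hk]
      exact he j hj k hk
  · have hTi : T \ {i} ⊆ J \ {i} := sdiff_subset_sdiff_left hT
    have ex : Function.update x i a '' (T \ {i}) = x '' (T \ {i}) :=
      image_congr fun j hj => hx j (hTi hj)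
    have ey : Function.update y i b '' (T \ {i}) = y '' (T \ {i}) :=
      image_congr fun j hj => hy j (hTi hj)
    by_cases hi : i ∈ T
    · rw [← insert_eq_of_mem hi, ← insert_sdiff_singleton, image_insert_eq, image_insert_eq, ex, ey,
        Function.update_self, Function.update_self, hbc _ (image_mono hTi)]
      congr 3
      ext w
      constructor
      · rintro ⟨j, ⟨hj, k, hk, hkj⟩, rfl⟩
        exact ⟨k, hk, (he k (hTi hk) j hj).2 hkj⟩
      · rintro ⟨j, hj, rfl⟩
        exact ⟨j, ⟨hTi hj, mem_image_of_mem y hj⟩, rfl⟩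
    · rw [sdiff_singleton_eq_self hi] at ex ey hTi
      rw [ex, ey]
      exact hc T hTi (hbij.congr fun j hj => congrArg label (hx j (hTi hj)))

end SimilarOn

end Similarity

/-! ### Cylindric algebras of sets of sequences -/

section SetAlgebra

variable {I : Type} {M : Type u}

/-- The set-theoretic diagonal. -/
def setDiag (i j : I) : Set (I → M) := {x | x i = x j}

theorem setDiag_self (i : I) : (setDiag i i : Set (I → M)) = Set.univ :=
  Set.eq_univ_of_forall fun _ => rfl

variable [DecidableEq I]

/-- The set-theoretic cylindrification. -/
def setCyl (i : I) (X : Set (I → M)) : Set (I → M) := {x | ∃ a, Function.update x i a ∈ X}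

theorem setCyl_setCyl_subset (i j : I) (X : Set (I → M)) :
    setCyl i (setCyl j X) ⊆ setCyl j (setCyl i X) := by
  rintro x ⟨a, b, h⟩
  by_cases hij : i = j
  · subst hij
    exact ⟨a, b, h⟩
  · exact ⟨b, a, by rwa [Function.update_comm (Ne.symm hij)]⟩

/-- A Boolean algebra of sets of sequences which is closed under the set-theoretic cylindrifications
and contains the diagonals is a cylindric algebra. -/
@[reducible]
def CylindricAlgebra.ofSets (S : BooleanSubalgebra (Set (I → M)))
    (hc : ∀ i, ∀ X ∈ S, setCyl i X ∈ S) (hd : ∀ i j, setDiag i j ∈ S) : CylindricAlgebra I S where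
  cyl i X := ⟨setCyl i X, hc i X X.2⟩
  diag i j := ⟨setDiag i j, hd i j⟩
  cyl_bot i := Subtype.ext <| Set.eq_empty_of_forall_notMem fun _ h => h.choose_spec
  le_cyl i X := fun x hx => ⟨x i, by rwa [Function.update_eq_self]⟩
  cyl_inf_cyl i X Y := Subtype.ext <| Set.ext fun x => by
    constructor
    · rintro ⟨a, h, b, h'⟩
      exact ⟨⟨a, h⟩, b, by rwa [Function.update_idem] at h'⟩
    · rintro ⟨⟨a, h⟩, b, h'⟩
      exact ⟨a, h, b, by rwa [Function.update_idem]⟩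
  cyl_comm i j X := Subtype.ext <|
    (setCyl_setCyl_subset i j X.1).antisymm (setCyl_setCyl_subset j i X.1)
  diag_self i := Subtype.ext (setDiag_self i)
  diag_eq i j k hi hj := Subtype.ext <| Set.ext fun x => by
    constructor
    · intro h
      refine ⟨x i, ?_, ?_⟩
      · simp [setDiag, Function.update_of_ne hi.symm]
      · simpa [setDiag, Function.update_of_ne hj.symm] using h
    · rintro ⟨a, h, h'⟩
      simp only [setDiag, Set.mem_ofPred_eq, Function.update_of_ne hi.symm,
        Function.update_of_ne hj.symm, Function.update_self] at h h'
      exact h.trans h'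
  cyl_diag_inf i j X hij := Subtype.ext <| Set.eq_empty_of_forall_notMem fun x => by
    rintro ⟨⟨a, h, h1⟩, b, h', h2⟩
    simp only [setDiag, Set.mem_ofPred_eq, Function.update_of_ne hij.symm,
        Function.update_self] at h h'
    subst h h'
    exact h2 h1

end SetAlgebra

section SimilarityAlgebra

open Point Set

variable {I N : Type} {K : Type u} [Nonempty K]

/-- A set of sequences which, for a finite index set `J` and a finite set `F` of colours, is closed
under similarity on `J` over `F`. -/
def FinitelySupported (X : Set (I → Point N K)) : Prop :=
  ∃ (J : Set I) (F : Set K), J.Finite ∧ F.Finite ∧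
    ∀ x y, SimilarOn J F x y → (x ∈ X ↔ y ∈ X)

theorem FinitelySupported.of_forall_imp {X : Set (I → Point N K)} {J : Set I} {F : Set K}
    (hJ : J.Finite) (hF : F.Finite) (h : ∀ x y, SimilarOn J F x y → x ∈ X → y ∈ X) :
    FinitelySupported X :=
  ⟨J, F, hJ, hF, fun x y hxy => ⟨h x y hxy, h y x hxy.symm⟩⟩

theorem FinitelySupported.setDiag (i j : I) :
    FinitelySupported (setDiag i j : Set (I → Point N K)) :=
  ⟨{i, j}, ∅, toFinite _, finite_empty, fun _ _ h => h.2.1 i (by simp) j (by simp)⟩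

theorem FinitelySupported.setCyl [DecidableEq I] {X : Set (I → Point N K)}
    (hX : FinitelySupported X) (i : I) : FinitelySupported (setCyl i X) := by
  obtain ⟨J, F, hJ, hF, h⟩ := hX
  refine .of_forall_imp hJ hF fun x y hxy => ?_
  rintro ⟨a, ha⟩
  obtain ⟨b, hb⟩ := (hxy.mono sdiff_subset Subset.rfl).exists_update (i := i) hJ a
  exact ⟨b, (h _ _ hb).1 ha⟩

variable (I N K) in
/-- The Boolean algebra of all finitely supported sets of sequences of points. -/
def supportedAlgebra : BooleanSubalgebra (Set (I → Point N K)) where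
  carrier := {X | FinitelySupported X}
  supClosed' := by
    rintro X ⟨J, F, hJ, hF, h⟩ Y ⟨J', F', hJ', hF', h'⟩
    refine ⟨J ∪ J', F ∪ F', hJ.union hJ', hF.union hF', fun x y hxy => ?_⟩
    exact or_congr (h x y (hxy.mono subset_union_left subset_union_left))
      (h' x y (hxy.mono subset_union_right subset_union_right))
  infClosed' := by
    rintro X ⟨J, F, hJ, hF, h⟩ Y ⟨J', F', hJ', hF', h'⟩
    refine ⟨J ∪ J', F ∪ F', hJ.union hJ', hF.union hF', fun x y hxy => ?_⟩
    exact and_congr (h x y (hxy.mono subset_union_left subset_union_left))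
      (h' x y (hxy.mono subset_union_right subset_union_right))
  compl_mem' := by
    rintro X ⟨J, F, hJ, hF, h⟩
    exact ⟨J, F, hJ, hF, fun x y hxy => not_congr (h x y hxy)⟩
  bot_mem' := ⟨∅, ∅, finite_empty, finite_empty, fun _ _ _ => Iff.rfl⟩

instance [DecidableEq I] : CylindricAlgebra I (supportedAlgebra I N K) :=
  CylindricAlgebra.ofSets _ (fun i _ hX => FinitelySupported.setCyl hX i)
    FinitelySupported.setDiag

end SimilarityAlgebra

/-! ### Homomorphisms of cylindric algebras -/

namespace CylindricAlgebra

section Hom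

variable {I : Type} {A B : Type u} [CylindricAlgebra I A] [CylindricAlgebra I B]

/-- An order isomorphism preserving cylindrifications and diagonals, as an isomorphism of
first-order structures. -/
def langEquiv (e : A ≃o B) (hc : ∀ i x, e (cyl (I := I) i x) = cyl i (e x))
    (hd : ∀ i j : I, e (diag i j) = diag i j) : A ≃[lang I] B where
  toEquiv := e.toEquiv
  map_fun' f v := by
    cases f with
    | sup => exact map_sup e _ _
    | inf => exact map_inf e _ _
    | compl => exact map_compl e _
    | bot => exact map_bot e
    | top => exact map_top e
    | cyl i => exact hc i _
    | diag i j => exact hd i j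
  map_rel' r := r.elim

variable (f : A ↪[lang I] B)

theorem map_cyl (i : I) (x : A) : f (cyl i x) = cyl i (f x) :=
  f.map_fun (Func.cyl i : (lang I).Functions 1) ![x]

theorem map_diag (i j : I) : f (diag i j) = diag i j :=
  f.map_fun (Func.diag i j : (lang I).Functions 0) ![]

theorem embedding_map_bot : f ⊥ = ⊥ :=
  f.map_fun (Func.bot : (lang I).Functions 0) ![]

theorem embedding_map_inf (x y : A) : f (x ⊓ y) = f x ⊓ f y :=
  f.map_fun (Func.inf : (lang I).Functions 2) ![x, y]

theorem embedding_le_iff {x y : A} : f x ≤ f y ↔ x ≤ y := by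
  rw [← inf_eq_left, ← embedding_map_inf, f.injective.eq_iff, inf_eq_left]

end Hom

end CylindricAlgebra

/-! ### The neat reduct of the infinite-dimensional algebra -/

section Neat

open Point Set

variable {n : ℕ} {N : Type} {K : Type u} [Nonempty K]

/-- Membership in a finitely supported set does not depend on the coordinates whose
cylindrifications fix the set. -/
theorem mem_of_eqOn_of_fixed {I : Type} [DecidableEq I] {X : Set (I → Point N K)}
    (hX : FinitelySupported X) {S : Set I} (hS : ∀ j ∉ S, setCyl j X = X) {x y : I → Point N K}
    (h : EqOn x y S) (hx : x ∈ X) : y ∈ X := by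
  classical
  obtain ⟨J, F, hJ, -, hXs⟩ := hX
  -- Coordinates outside `S` can be changed one at a time; only the finitely many in `J` matter.
  have key : ∀ T : Finset I, (∀ j ∈ T, j ∉ S) → T.piecewise y x ∈ X := by
    intro T
    induction T using Finset.induction_on with
    | empty => simpa using hx
    | insert j T _ ih =>
      intro hT
      rw [Finset.piecewise_insert, ← hS j (hT j (by simp))]
      refine ⟨T.piecewise y x j, ?_⟩
      rw [Function.update_idem, Function.update_eq_self]
      exact ih fun k hk => hT k (by simp [hk])
  have hfin : (J \ S).Finite := hJ.subset sdiff_subset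
  refine (hXs _ _ (.of_eqOn fun j hj => ?_)).1 (key hfin.toFinset (by simp))
  by_cases hjS : j ∈ S
  · rw [Finset.piecewise_eq_of_notMem _ _ _ (by simp [hjS]), h hjS]
  · rw [Finset.piecewise_eq_of_mem _ _ _ (by simp [hj, hjS])]

/-- The cylinder over a set of `n`-sequences, as an element of the neat reduct. -/
def cylinder (X : supportedAlgebra (Fin n) N K) :
    neatSubalgebra (Fin.valEmbedding : Fin n ↪ ℕ) (supportedAlgebra ℕ N K) :=
  ⟨⟨{x | x ∘ Fin.val ∈ X.1}, by
    obtain ⟨J, F, hJ, hF, h⟩ := X.2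
    exact ⟨Fin.val '' J, F, hJ.image _, hF, fun x y hxy =>
      h _ _ (hxy.comp Fin.val (mapsTo_image _ _))⟩⟩, fun j hj => by
    by_contra hr
    have hu : ∀ (x : ℕ → Point N K) a, Function.update x j a ∘ Fin.val = x ∘ (Fin.val : Fin n → ℕ) :=
      fun x a => Function.update_comp_eq_of_notMem_range _ _ hr
    refine hj (Subtype.ext <| Set.ext fun x => ⟨?_, fun hx => ⟨x j, ?_⟩⟩)
    · rintro ⟨a, ha⟩
      have ha : Function.update x j a ∘ Fin.val ∈ X.1 := ha
      rwa [hu] at ha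
    · rwa [Function.update_eq_self]⟩

variable [NeZero n]

variable (n N K) in
/-- The algebra of finitely supported sets of `n`-sequences is the neat reduct of the algebra of
finitely supported sets of infinite sequences. -/
def cylinderIso : supportedAlgebra (Fin n) N K ≃o
    neatSubalgebra (Fin.valEmbedding : Fin n ↪ ℕ) (supportedAlgebra ℕ N K) where
  toFun := cylinder
  invFun Y := ⟨{x | x ∘ Fin.ofNat n ∈ Y.1.1}, by
    obtain ⟨J, F, hJ, hF, h⟩ := Y.1.2
    exact ⟨univ, F, finite_univ, hF, fun x y hxy => h _ _ (hxy.comp _ (mapsTo_univ _ _))⟩⟩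
  left_inv X := Subtype.ext <| Set.ext fun x => by
    change (x ∘ Fin.ofNat n) ∘ Fin.val ∈ X.1 ↔ x ∈ X.1
    have : (x ∘ Fin.ofNat n) ∘ Fin.val = x := funext fun i => by simp
    rw [this]
  right_inv Y := Subtype.ext <| Subtype.ext <| Set.ext fun x => by
    change (x ∘ Fin.val) ∘ Fin.ofNat n ∈ Y.1.1 ↔ x ∈ Y.1.1
    have hfix : ∀ j ∉ range (Fin.valEmbedding : Fin n ↪ ℕ), setCyl j Y.1.1 = Y.1.1 :=
      fun j hj => congrArg Subtype.val (not_not.1 (mt (Y.2 j) hj))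
    have he : EqOn ((x ∘ Fin.val) ∘ Fin.ofNat n) x (range (Fin.valEmbedding : Fin n ↪ ℕ)) := by
      rintro _ ⟨i, rfl⟩
      simp
    exact ⟨mem_of_eqOn_of_fixed Y.1.2 hfix he, mem_of_eqOn_of_fixed Y.1.2 hfix he.symm⟩
  map_rel_iff' {X Y} := by
    refine ⟨fun h x hx => ?_, fun h x hx => h hx⟩
    have h' : x ∘ Fin.ofNat n ∘ Fin.val ∈ Y.1 := @h (x ∘ Fin.ofNat n) (by
      change (x ∘ Fin.ofNat n) ∘ Fin.val ∈ X.1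
      have : (x ∘ Fin.ofNat n) ∘ Fin.val = x := funext fun i => by simp
      rwa [this])
    have : x ∘ Fin.ofNat n ∘ Fin.val = x := funext fun i => by simp
    rwa [this] at h'

theorem supportedAlgebra_mem_nrOmega :
    (⟨supportedAlgebra (Fin n) N K⟩ : CylAlg.{u} (Fin n)) ∈ NrOmega n := by
  refine ⟨⟨supportedAlgebra ℕ N K⟩, ⟨langEquiv (cylinderIso n N K) (fun i X => ?_)
    fun i j => rfl⟩⟩
  refine Subtype.ext <| Subtype.ext <| Set.ext fun x => exists_congr fun a => ?_
  change Function.update (x ∘ Fin.val) i a ∈ X.1 ↔ Function.update x i.val a ∘ Fin.val ∈ X.1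
  rw [Function.update_comp_eq_of_injective _ Fin.val_injective]

end Neat

/-! ### Colours of sequences with given labels -/

section Box

open Point Set

variable {n : ℕ} {K : Type u}

/-- The sequences in which the labels are given by `u`. -/
def box (K : Type u) (u : Fin n → Fin n) : Set (Fin n → Point (Fin n) K) :=
  {x | ∀ i, (x i).label = u i}

theorem injective_of_mem_box {u : Fin n → Fin n} (hu : u.Injective) {x : Fin n → Point (Fin n) K}
    (hx : x ∈ box K u) : x.Injective := fun i j h => hu (by rw [← hx i, ← hx j, h])

theorem eq_univ_of_bijOn {h : Fin n → Fin n} {T : Set (Fin n)} (hT : BijOn h T univ) :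
    T = univ := by
  have hs : h.Surjective := fun p => (hT.surjOn (mem_univ p)).imp fun _ h => h.2
  refine eq_univ_of_forall fun i => ?_
  obtain ⟨j, hj, hij⟩ := hT.surjOn (mem_univ (h i))
  rwa [← Finite.injective_iff_surjective.2 hs hij]

variable [Nonempty K] {u : Fin n → Fin n} {x y : Fin n → Point (Fin n) K} {F : Set K}

theorem SimilarOn.colour_range (h : SimilarOn univ univ x y)
    (hx : BijOn (fun i => (x i).label) univ univ) : colour (range y) = colour (range x) := by
  obtain ⟨-, -, σ, hσ, hc⟩ := h
  have := hc univ Subset.rfl hx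
  rwa [hσ _ (mem_univ _), image_univ, image_univ] at this

theorem similarOn_compl_of_mem_box (hu : u.Injective) (hx : x ∈ box K u) (hy : y ∈ box K u)
    (i : Fin n) : SimilarOn (univ \ {i}) univ x y := by
  refine ⟨fun j _ => (hx j).trans (hy j).symm, fun j _ k _ => ?_, 1, fun _ _ => rfl,
    fun T hT hb => ?_⟩
  · rw [(injective_of_mem_box hu hx).eq_iff, (injective_of_mem_box hu hy).eq_iff]
  -- A set of fewer than `n` indices cannot carry all labels, so there are no colours to compare.
  · rw [eq_univ_of_bijOn hb] at hT
    exact ((hT (mem_univ i)).2 rfl).elim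

/-- Colours outside a set of colours can be exchanged while fixing that set. -/
theorem similarOn_of_mem_box (hu : u.Injective) (hx : x ∈ box K u) (hy : y ∈ box K u)
    (h : ∀ k ∈ F, colour (range x) = k ↔ colour (range y) = k) : SimilarOn univ F x y := by
  classical
  refine ⟨fun j _ => (hx j).trans (hy j).symm, fun j _ k _ => ?_,
    Equiv.swap (colour (range x)) (colour (range y)), fun k hk => ?_, fun T _ hb => ?_⟩
  · rw [(injective_of_mem_box hu hx).eq_iff, (injective_of_mem_box hu hy).eq_iff]
  · by_cases hkx : colour (range x) = k
    · rw [hkx, (h k hk).1 hkx, Equiv.swap_self, Equiv.refl_apply]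
    · exact Equiv.swap_apply_of_ne_of_ne (Ne.symm hkx) (Ne.symm (mt (h k hk).2 hkx))
  · rw [eq_univ_of_bijOn hb, image_univ, image_univ, Equiv.swap_apply_left]

theorem exists_mem_box [NeZero n] (u : Fin n → Fin n) (k : K) :
    ∃ x ∈ box K u, colour (range x) = k := by
  let y : Fin n → Point (Fin n) K := fun i => .mk (u i) 0 Fin.elim0 fun _ => k
  obtain ⟨z, -, hz, hc⟩ := exists_extension (toFinite (y '' {0}ᶜ)) (u 0) fun _ => k
  refine ⟨Function.update y 0 z, fun i => ?_, ?_⟩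
  · by_cases hi : i = 0
    · subst hi
      rw [Function.update_self, hz]
    · rw [Function.update_of_ne hi]
      rfl
  · have hr : range (Function.update y 0 z) = insert z (y '' {0}ᶜ) := by
      rw [← image_univ, ← insert_eq_of_mem (mem_univ (0 : Fin n)), ← insert_sdiff_singleton,
        image_insert_eq, Function.update_self, ← compl_eq_univ_sdiff]
      congr 1
      exact image_congr fun i hi => Function.update_of_ne hi _ _
    rw [hr, hc _ Subset.rfl]

theorem mem_iff_of_similarOn {X : Set (Fin n → Point (Fin n) K)} (hX : FinitelySupported X)
    (h : SimilarOn univ univ x y) : x ∈ X ↔ y ∈ X := by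
  obtain ⟨J, F, -, -, hs⟩ := hX
  exact hs x y (h.mono (subset_univ _) (subset_univ _))

theorem mem_iff_of_mem_box {X : Set (Fin n → Point (Fin n) K)} (hX : FinitelySupported X)
    (hu : u.Injective) (hx : x ∈ box K u) (hy : y ∈ box K u)
    (h : colour (range x) = colour (range y)) : x ∈ X ↔ y ∈ X :=
  mem_iff_of_similarOn hX (similarOn_of_mem_box hu hx hy fun k _ => by rw [h])

theorem FinitelySupported.exists_univ {X : Set (Fin n → Point (Fin n) K)}
    (hX : FinitelySupported X) :
    ∃ F : Set K, F.Finite ∧ ∀ x y, SimilarOn univ F x y → (x ∈ X ↔ y ∈ X) := by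
  obtain ⟨J, F, -, hF, hs⟩ := hX
  exact ⟨F, hF, fun x y h => hs x y (h.mono (subset_univ _) Subset.rfl)⟩

theorem mem_setCyl_iff {X : Set (Fin n → Point (Fin n) K)} (hX : FinitelySupported X) {i : Fin n}
    (h : SimilarOn (univ \ {i}) univ x y) : x ∈ setCyl i X ↔ y ∈ setCyl i X := by
  have key : ∀ {x y}, SimilarOn (univ \ {i}) univ x y → x ∈ setCyl i X → y ∈ setCyl i X := by
    rintro x y h ⟨a, ha⟩
    obtain ⟨b, hb⟩ := h.exists_update (toFinite _) a
    exact ⟨b, (mem_iff_of_similarOn hX hb).1 ha⟩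
  exact ⟨key h, key h.symm⟩

/-- The set of all sequences of the same isomorphism type. -/
def similarityClass (x : Fin n → Point (Fin n) K) : Set (Fin n → Point (Fin n) K) :=
  {y | SimilarOn univ univ x y}

theorem finitelySupported_similarityClass (x : Fin n → Point (Fin n) K) :
    FinitelySupported (similarityClass x) := by
  refine .of_forall_imp finite_univ (finite_singleton (colour (range x))) fun y y' h hy => ?_
  have hy : SimilarOn univ univ x y := hy
  refine ⟨fun i hi => (hy.1 i hi).trans (h.1 i hi),
    fun i hi j hj => (hy.2.1 i hi j hj).trans (h.2.1 i hi j hj), 1, fun _ _ => rfl,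
    fun T _ hb => ?_⟩
  obtain ⟨hl, -, σ, hσ, hc⟩ := h
  obtain rfl := eq_univ_of_bijOn hb
  rw [hc univ Subset.rfl (hb.congr fun i hi => hy.1 i hi), image_univ, image_univ,
    hy.colour_range hb, hσ _ rfl, Equiv.Perm.one_apply]

theorem exists_isAtom_le {S : BooleanSubalgebra (Set (Fin n → Point (Fin n) K))}
    (hS : ∀ X ∈ S, FinitelySupported X) (X : S) (hx : x ∈ X.1) (hxS : similarityClass x ∈ S) :
    ∃ Y : S, IsAtom Y ∧ Y ≤ X := by
  refine ⟨⟨similarityClass x, hxS⟩, ⟨fun h => ?_, fun Y hY => ?_⟩,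
    fun y hy => (mem_iff_of_similarOn (hS X X.2) hy).1 hx⟩
  · have : similarityClass x = ∅ := congrArg Subtype.val h
    exact (this ▸ SimilarOn.refl univ univ x : x ∈ (∅ : Set _))
  · by_contra hne
    have hne' : (Y : Set (Fin n → Point (Fin n) K)).Nonempty :=
      nonempty_iff_ne_empty.2 fun h => hne (Subtype.ext h)
    obtain ⟨y, hy⟩ := hne'
    have hxy : SimilarOn univ univ x y := hY.le hy
    exact hY.not_ge fun z hz => (mem_iff_of_similarOn (hS Y Y.2) (hxy.symm.trans hz)).1 hy

theorem isAtomic_supportedAlgebra : IsAtomic (supportedAlgebra (Fin n) (Fin n) K) := by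
  refine ⟨fun X => or_iff_not_imp_left.2 fun hX => ?_⟩
  obtain ⟨x, hx⟩ := nonempty_iff_ne_empty.2 fun h => hX (Subtype.ext h)
  exact exists_isAtom_le (fun _ h => h) X hx (finitelySupported_similarityClass x)

end Box

/-! ### The subalgebra with few colours on the identity box -/

section FewColours

open Point Set

variable {n : ℕ} {K : Type u} [Nonempty K]

/-- The set `X` does not separate any two colours outside `F` on the identity box. -/
def BoxSupported (F : Set K) (X : Set (Fin n → Point (Fin n) K)) : Prop :=
  ∀ x ∈ box K id, ∀ y ∈ box K id,
    (∀ k ∈ F, colour (range x) = k ↔ colour (range y) = k) → (x ∈ X ↔ y ∈ X)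

theorem BoxSupported.mono {F F' : Set K} {X : Set (Fin n → Point (Fin n) K)} (h : F ⊆ F')
    (hX : BoxSupported F X) : BoxSupported F' X :=
  fun x hx y hy hxy => hX x hx y hy fun k hk => hxy k (h hk)

variable (n) in
/-- The finitely supported sets which separate only finitely many colours on the identity box, all
of them from `K₀`. -/
def fewColours (K₀ : Set K) : BooleanSubalgebra (Set (Fin n → Point (Fin n) K)) where
  carrier := {X | FinitelySupported X ∧ ∃ F ⊆ K₀, F.Finite ∧ BoxSupported F X}
  supClosed' := by
    rintro X ⟨hX, F, hF, hf, h⟩ Y ⟨hY, F', hF', hf', h'⟩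
    exact ⟨(supportedAlgebra (Fin n) (Fin n) K).supClosed hX hY, F ∪ F', union_subset hF hF',
      hf.union hf', fun x hx y hy hxy => or_congr
        (h.mono subset_union_left x hx y hy hxy) (h'.mono subset_union_right x hx y hy hxy)⟩
  infClosed' := by
    rintro X ⟨hX, F, hF, hf, h⟩ Y ⟨hY, F', hF', hf', h'⟩
    exact ⟨(supportedAlgebra (Fin n) (Fin n) K).infClosed hX hY, F ∪ F', union_subset hF hF',
      hf.union hf', fun x hx y hy hxy => and_congr
        (h.mono subset_union_left x hx y hy hxy) (h'.mono subset_union_right x hx y hy hxy)⟩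
  compl_mem' := by
    rintro X ⟨hX, F, hF, hf, h⟩
    exact ⟨(supportedAlgebra (Fin n) (Fin n) K).compl_mem hX, F, hF, hf,
      fun x hx y hy hxy => not_congr (h x hx y hy hxy)⟩
  bot_mem' := ⟨(supportedAlgebra (Fin n) (Fin n) K).bot_mem, ∅, empty_subset _, finite_empty,
    fun _ _ _ _ _ => Iff.rfl⟩

variable {K₀ : Set K}

theorem finitelySupported_of_mem_fewColours {X : Set (Fin n → Point (Fin n) K)}
    (hX : X ∈ fewColours n K₀) : FinitelySupported X := hX.1

theorem mem_fewColours_of_boxSupported_empty {X : Set (Fin n → Point (Fin n) K)}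
    (hX : FinitelySupported X) (h : BoxSupported ∅ X) : X ∈ fewColours n K₀ :=
  ⟨hX, ∅, empty_subset _, finite_empty, h⟩

instance : CylindricAlgebra (Fin n) (fewColours n K₀) :=
  CylindricAlgebra.ofSets _
    (fun i _ hX => mem_fewColours_of_boxSupported_empty (hX.1.setCyl i) fun _ hx _ hy _ =>
      mem_setCyl_iff hX.1 (similarOn_compl_of_mem_box Function.injective_id hx hy i))
    fun i j => mem_fewColours_of_boxSupported_empty (.setDiag i j) fun x hx y hy _ => by
      change x i = x j ↔ y i = y j
      rw [(injective_of_mem_box Function.injective_id hx).eq_iff,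
        (injective_of_mem_box Function.injective_id hy).eq_iff]

theorem exists_mem_colour_mem [NeZero n] (hK : K₀.Infinite) {X : Set (Fin n → Point (Fin n) K)}
    (hX : X ∈ fewColours n K₀) {x : Fin n → Point (Fin n) K} (hx : x ∈ box K id) (hxX : x ∈ X) :
    ∃ y ∈ box K id, y ∈ X ∧ colour (range y) ∈ K₀ := by
  by_cases hc : colour (range x) ∈ K₀
  · exact ⟨x, hx, hxX, hc⟩
  obtain ⟨-, F, hF, hf, h⟩ := hX
  obtain ⟨k, hk, hkF⟩ := hK.exists_notMem_finite hf
  obtain ⟨y, hy, rfl⟩ := exists_mem_box (id : Fin n → Fin n) k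
  refine ⟨y, hy, (h x hx y hy fun k hk => iff_of_false ?_ ?_).1 hxX, hk⟩
  · rintro rfl
    exact hc (hF hk)
  · rintro rfl
    exact hkF hk

theorem isAtomic_fewColours [NeZero n] (hK : K₀.Infinite) : IsAtomic (fewColours n K₀) := by
  refine ⟨fun X => or_iff_not_imp_left.2 fun hX => ?_⟩
  obtain ⟨x, hx⟩ := nonempty_iff_ne_empty.2 fun h => hX (Subtype.ext h)
  obtain ⟨y, hyX, hy⟩ : ∃ y ∈ X.1, y ∈ box K id → colour (range y) ∈ K₀ := by
    by_cases hb : x ∈ box K id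
    · obtain ⟨y, -, hyX, hy⟩ := exists_mem_colour_mem hK X.2 hb hx
      exact ⟨y, hyX, fun _ => hy⟩
    · exact ⟨x, hx, fun h => (hb h).elim⟩
  refine exists_isAtom_le (fun _ h => finitelySupported_of_mem_fewColours h) X hyX ?_
  have hfs := finitelySupported_similarityClass y
  by_cases hb : y ∈ box K id
  · refine ⟨hfs, {colour (range y)}, singleton_subset_iff.2 (hy hb), finite_singleton _, ?_⟩
    have key : ∀ z ∈ box K id, z ∈ similarityClass y ↔ colour (range z) = colour (range y) := by
      refine fun z hz => ⟨fun h => SimilarOn.colour_range h ?_, fun h =>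
        similarOn_of_mem_box Function.injective_id hb hz fun k _ => by rw [h]⟩
      exact (bijOn_id univ).congr fun i _ => (hb i).symm
    intro z hz w hw hzw
    rw [key z hz, key w hw, hzw _ rfl]
  · have key : ∀ z ∈ box K id, z ∉ similarityClass y := fun z hz h =>
      hb fun i => (SimilarOn.symm h).1 i (mem_univ i) ▸ hz i
    exact mem_fewColours_of_boxSupported_empty hfs fun z hz w hw _ =>
      iff_of_false (key z hz) (key w hw)

end FewColours

/-! ### Recolouring the identity box -/

section Recolour

open Point Set

variable {n : ℕ} {K : Type u} [Nonempty K]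

/-- `x` arises from `y` by permuting the colours on the identity box and nowhere else. -/
def Recolours (τ : Equiv.Perm K) (x y : Fin n → Point (Fin n) K) : Prop :=
  (x ∉ box K id ∧ x = y) ∨ (x ∈ box K id ∧ y ∈ box K id ∧
    colour (range x) = τ (colour (range y)))

/-- The action on sets of sequences of a permutation of the colours on the identity box. -/
def recolour (τ : Equiv.Perm K) (X : Set (Fin n → Point (Fin n) K)) :
    Set (Fin n → Point (Fin n) K) :=
  {x | ∃ y ∈ X, Recolours τ x y}

variable {τ : Equiv.Perm K} {x y : Fin n → Point (Fin n) K}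
  {X : Set (Fin n → Point (Fin n) K)}

theorem Recolours.symm (h : Recolours τ x y) : Recolours τ.symm y x := by
  rcases h with ⟨h, rfl⟩ | ⟨hx, hy, h⟩
  · exact Or.inl ⟨h, rfl⟩
  · exact Or.inr ⟨hy, hx, by rw [h, Equiv.symm_apply_apply]⟩

theorem Recolours.similarOn (h : Recolours τ x y) (i : Fin n) :
    SimilarOn (univ \ {i}) univ x y := by
  rcases h with ⟨-, rfl⟩ | ⟨hx, hy, -⟩
  · exact .refl _ _ _
  · exact similarOn_compl_of_mem_box Function.injective_id hx hy i

theorem mem_recolour_iff (hX : FinitelySupported X) (h : Recolours τ x y) :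
    x ∈ recolour τ X ↔ y ∈ X := by
  refine ⟨?_, fun hy => ⟨y, hy, h⟩⟩
  rintro ⟨z, hz, hxz⟩
  rcases h with ⟨hx, rfl⟩ | ⟨hx, hy, h⟩ <;> rcases hxz with ⟨hx', rfl⟩ | ⟨hx', hz', h'⟩
  · exact hz
  · exact (hx hx').elim
  · exact (hx' hx).elim
  · exact (mem_iff_of_mem_box hX Function.injective_id hz' hy
      (τ.injective (h'.symm.trans h))).1 hz

theorem exists_recolours [NeZero n] (τ : Equiv.Perm K) (x : Fin n → Point (Fin n) K) :
    ∃ y, Recolours τ x y := by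
  by_cases hx : x ∈ box K id
  · obtain ⟨y, hy, hc⟩ := exists_mem_box (id : Fin n → Fin n) (τ.symm (colour (range x)))
    exact ⟨y, Or.inr ⟨hx, hy, by rw [hc, Equiv.apply_symm_apply]⟩⟩
  · exact ⟨x, Or.inl ⟨hx, rfl⟩⟩

variable [NeZero n]

theorem FinitelySupported.recolour (hX : FinitelySupported X) (τ : Equiv.Perm K) :
    FinitelySupported (recolour τ X) := by
  obtain ⟨F, hF, hs⟩ := hX.exists_univ
  refine ⟨univ, F ∪ τ '' F, finite_univ, hF.union (hF.image τ), fun x x' h => ?_⟩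
  obtain ⟨y, hy⟩ := exists_recolours τ x
  obtain ⟨y', hy'⟩ := exists_recolours τ x'
  rw [mem_recolour_iff hX hy, mem_recolour_iff hX hy']
  have hbox : x ∈ box K id ↔ x' ∈ box K id :=
    forall_congr' fun i => by rw [h.1 i (mem_univ i)]
  rcases hy with ⟨hx, rfl⟩ | ⟨hx, hyb, hc⟩ <;> rcases hy' with ⟨hx', rfl⟩ | ⟨hx', hyb', hc'⟩
  · exact hs _ _ (h.mono Subset.rfl subset_union_left)
  · exact (hx (hbox.2 hx')).elim
  · exact (hx' (hbox.1 hx)).elim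
  · refine hs _ _ (similarOn_of_mem_box Function.injective_id hyb hyb' fun k hk => ?_)
    obtain ⟨-, -, σ, hσ, hcol⟩ := h
    have hcol := hcol univ Subset.rfl ((bijOn_id univ).congr fun i _ => (hx i).symm)
    rw [image_univ, image_univ, hc, hc'] at hcol
    have hk' : σ (τ k) = τ k := hσ _ (Or.inr (mem_image_of_mem τ hk))
    rw [← τ.injective.eq_iff (a := colour (range y')), hcol, ← hk', σ.injective.eq_iff,
      τ.injective.eq_iff]

theorem recolour_symm_recolour (hX : FinitelySupported X) (τ : Equiv.Perm K) :
    recolour τ.symm (recolour τ X) = X := by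
  ext x
  obtain ⟨y, hy⟩ := exists_recolours τ.symm x
  have hy' : Recolours τ y x := hy.symm
  rw [mem_recolour_iff (hX.recolour τ) hy, mem_recolour_iff hX hy']

theorem recolour_setCyl (hX : FinitelySupported X) (i : Fin n) :
    recolour τ (setCyl i X) = setCyl i (recolour τ X) := by
  ext x
  obtain ⟨y, hxy⟩ := exists_recolours τ x
  rw [mem_recolour_iff (hX.setCyl i) hxy, ← mem_setCyl_iff hX (hxy.similarOn i)]
  constructor
  · rintro ⟨a, ha⟩
    obtain ⟨z, hz⟩ := exists_recolours τ.symm (Function.update x i a)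
    have hmem : z ∈ setCyl i (recolour τ X) :=
      ⟨z i, by rw [Function.update_eq_self]; exact ⟨_, ha, hz.symm⟩⟩
    obtain ⟨b, hb⟩ := (mem_setCyl_iff (hX.recolour τ) (hz.similarOn i)).2 hmem
    exact ⟨b, by rwa [Function.update_idem] at hb⟩
  · rintro ⟨a, z, hz, hr⟩
    have hmem : z ∈ setCyl i X := ⟨z i, by rwa [Function.update_eq_self]⟩
    obtain ⟨b, hb⟩ := (mem_setCyl_iff hX (hr.similarOn i)).2 hmem
    exact ⟨b, by rwa [Function.update_idem] at hb⟩

theorem recolour_setDiag (i j : Fin n) :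
    recolour τ (setDiag i j) = (setDiag i j : Set (Fin n → Point (Fin n) K)) := by
  ext x
  obtain ⟨y, hxy⟩ := exists_recolours τ x
  rw [mem_recolour_iff (.setDiag i j) hxy]
  rcases hxy with ⟨-, rfl⟩ | ⟨hx, hy, -⟩
  · rfl
  · change y i = y j ↔ x i = x j
    rw [(injective_of_mem_box Function.injective_id hx).eq_iff,
      (injective_of_mem_box Function.injective_id hy).eq_iff]

variable (n) in
/-- Recolouring the identity box is an automorphism. -/
def recolourIso (τ : Equiv.Perm K) :
    supportedAlgebra (Fin n) (Fin n) K ≃[lang (Fin n)] supportedAlgebra (Fin n) (Fin n) K :=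
  langEquiv
    { toFun X := ⟨recolour τ X.1, X.2.recolour τ⟩
      invFun X := ⟨recolour τ.symm X.1, X.2.recolour τ.symm⟩
      left_inv X := Subtype.ext (recolour_symm_recolour X.2 τ)
      right_inv X := Subtype.ext (recolour_symm_recolour X.2 τ.symm)
      map_rel_iff' {X Y} := by
        refine ⟨fun h x hx => ?_, fun h x ⟨y, hy, hxy⟩ => ⟨y, h hy, hxy⟩⟩
        obtain ⟨y, hy⟩ := exists_recolours τ.symm x
        exact (mem_recolour_iff Y.2 hy.symm).1 (h ⟨x, hx, hy.symm⟩) }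
    (fun i X => Subtype.ext (recolour_setCyl X.2 i))
    fun i j => Subtype.ext (recolour_setDiag i j)

theorem recolour_eq_self (hX : FinitelySupported X) {F : Set K} (hF : BoxSupported F X)
    (hτ : ∀ k ∈ F, τ k = k) : recolour τ X = X := by
  ext x
  obtain ⟨y, hxy⟩ := exists_recolours τ x
  rw [mem_recolour_iff hX hxy]
  rcases hxy with ⟨-, rfl⟩ | ⟨hx, hy, h⟩
  · rfl
  · refine hF y hy x hx fun k hk => ?_
    rw [h, ← τ.injective.eq_iff, hτ k hk]

theorem boxSupported_recolour (hX : FinitelySupported X) {F : Set K}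
    (hF : ∀ x y, SimilarOn univ F x y → (x ∈ X ↔ y ∈ X)) :
    BoxSupported (τ '' F) (recolour τ X) := by
  intro x hx x' hx' h
  obtain ⟨y, hy⟩ := exists_recolours τ x
  obtain ⟨y', hy'⟩ := exists_recolours τ x'
  rw [mem_recolour_iff hX hy, mem_recolour_iff hX hy']
  obtain ⟨-, hyb, hc⟩ := hy.resolve_left fun h => h.1 hx
  obtain ⟨-, hyb', hc'⟩ := hy'.resolve_left fun h => h.1 hx'
  refine hF _ _ (similarOn_of_mem_box Function.injective_id hyb hyb' fun k hk => ?_)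
  have := h (τ k) (mem_image_of_mem τ hk)
  rwa [hc, hc', τ.injective.eq_iff, τ.injective.eq_iff] at this

/-- Finitely many elements can be moved into an infinite set while fixing finitely many given
elements of it. -/
theorem exists_perm_mapsTo {α : Type*} {S F₀ F : Set α} (hS : S.Infinite) (hF₀ : F₀.Finite)
    (hF₀S : F₀ ⊆ S) (hF : F.Finite) :
    ∃ τ : Equiv.Perm α, (∀ k ∈ F₀, τ k = k) ∧ MapsTo τ F S := by
  classical
  induction F, hF using Set.Finite.induction_on with
  | empty => exact ⟨1, fun _ _ => rfl, mapsTo_empty _ _⟩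
  | @insert a F ha hF ih =>
    obtain ⟨τ, hτ, hm⟩ := ih
    by_cases haS : τ a ∈ S
    · exact ⟨τ, hτ, fun k hk => hk.elim (fun h => h ▸ haS) fun h => hm h⟩
    obtain ⟨c, hc, hcF⟩ := hS.exists_notMem_finite (hF₀.union (hF.image τ))
    refine ⟨τ.trans (Equiv.swap (τ a) c), fun k hk => ?_, ?_⟩
    · rw [Equiv.trans_apply, hτ k hk]
      refine Equiv.swap_apply_of_ne_of_ne ?_ ?_
      · rintro rfl
        exact haS (hF₀S hk)
      · rintro rfl
        exact hcF (Or.inl hk)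
    · rintro k (rfl | hk)
      · rwa [Equiv.trans_apply, Equiv.swap_apply_left]
      · rw [Equiv.trans_apply, Equiv.swap_apply_of_ne_of_ne]
        · exact hm hk
        · exact τ.injective.ne (by rintro rfl; exact ha hk)
        · rintro rfl
          exact hcF (Or.inr (mem_image_of_mem τ hk))

variable (n) in
/-- The inclusion of the subalgebra with few colours. -/
def fewColoursInclusion (K₀ : Set K) :
    fewColours n K₀ ↪[lang (Fin n)] supportedAlgebra (Fin n) (Fin n) K where
  toFun X := ⟨X.1, X.2.1⟩
  inj' _ _ h := Subtype.ext (Subtype.mk.inj h)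
  map_fun' f v := by cases f <;> rfl
  map_rel' r := r.elim

/-- By the Tarski–Vaught test: a recolouring fixes given elements of the subalgebra and moves a
given element into it. -/
theorem fewColours_elementarilyEquivalent {K₀ : Set K} (hK : K₀.Infinite) :
    supportedAlgebra (Fin n) (Fin n) K ≅[lang (Fin n)] fewColours n K₀ := by
  refine (FirstOrder.Language.ElementaryEmbedding.elementarilyEquivalent
    ((fewColoursInclusion n K₀).toElementaryEmbedding fun m φ v a ha => ?_)).symm
  choose F hF hf hs using fun i => (v i).2.2
  obtain ⟨G, hG, hGs⟩ := a.2.exists_univ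
  obtain ⟨τ, hτ, hm⟩ := exists_perm_mapsTo hK (finite_iUnion hf) (iUnion_subset hF) hG
  refine ⟨⟨recolour τ a.1, a.2.recolour τ, τ '' G, hm.image_subset, hG.image τ,
    boxSupported_recolour a.2 hGs⟩, ?_⟩
  rw [← StrongHomClass.realize_boundedFormula (recolourIso n τ)] at ha
  convert ha using 1
  rw [Fin.comp_snoc]
  congr 1
  funext i
  exact Subtype.ext (recolour_eq_self (v i).2.1 (hs i)
    fun k hk => hτ k (mem_iUnion_of_mem i hk)).symm

end Recolour

/-! ### Substitutions in cylindric algebras -/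

namespace CylindricAlgebra

section Subst

variable {J : Type} {D : Type u} [CylindricAlgebra J D] {i j k : J} {x y : D}

theorem cyl_mono (i : J) (h : x ≤ y) : cyl i x ≤ cyl i y := by
  rw [← inf_eq_left.2 (h.trans (le_cyl i y)), cyl_inf_cyl]
  exact inf_le_right

/-- The substitution operator; in set algebras it replaces the `i`-th coordinate by the `j`-th. -/
def subst (i j : J) (x : D) : D := cyl i (diag i j ⊓ x)

theorem cyl_subst (i j : J) (x : D) : cyl i (subst i j x) = subst i j x := cyl_cyl _ _

theorem subst_mono (i j : J) (h : x ≤ y) : subst i j x ≤ subst i j y :=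
  cyl_mono i (inf_le_inf_left _ h)

theorem subst_le_of_fixed (hx : cyl i x = x) : subst i j x ≤ x :=
  (cyl_mono i inf_le_right).trans_eq hx

theorem subst_inf_eq_bot (hij : i ≠ j) (h : x ⊓ y = ⊥) : subst i j x ⊓ subst i j y = ⊥ := by
  have hy : y ≤ xᶜ := le_compl_iff_disjoint_left.2 (disjoint_iff.2 h)
  rw [eq_bot_iff, ← cyl_diag_inf i j x hij]
  exact inf_le_inf_left _ (subst_mono i j hy)

theorem cyl_diag_eq_top (hij : i ≠ j) : cyl j (diag i j : D) = ⊤ := by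
  rw [eq_top_iff, ← diag_self i, diag_eq i i j hij.symm hij.symm]
  exact cyl_mono j inf_le_left

theorem eq_bot_of_subst_eq_bot (hij : i ≠ j) (hx : cyl j x = x) (h : subst i j x = ⊥) :
    x = ⊥ := by
  have h0 : diag i j ⊓ cyl j x = ⊥ := by
    rw [hx, eq_bot_iff, ← h]
    exact le_cyl _ _
  have h1 := cyl_inf_cyl j (diag i j) x
  rwa [h0, cyl_bot, cyl_diag_eq_top hij, top_inf_eq, hx, eq_comm] at h1

theorem cyl_subst_of_fixed (hki : k ≠ i) (hkj : k ≠ j) (hx : cyl k x = x) :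
    cyl k (subst i j x) = subst i j x := by
  rw [subst, cyl_comm, cyl_inf_of_fixed (cyl_diag_of_ne hki hkj) hx]

theorem subst_subst (hki : k ≠ i) (hkj : k ≠ j) (hij : i ≠ j) (hx : cyl k x = x) :
    subst k j (subst i k x) = subst i j x := by
  have h1 : diag k j ⊓ cyl i (diag i k ⊓ x) = cyl i (diag i k ⊓ diag k j ⊓ cyl k x) := by
    rw [inf_comm, ← cyl_diag_of_ne (k := i) (D := D) hki.symm hij, ← cyl_inf_cyl,
      cyl_diag_of_ne hki.symm hij, hx, inf_right_comm]
  rw [subst, subst, h1, cyl_comm, cyl_inf_cyl, ← diag_eq i j k hki hkj, hx, subst]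

/-- The operator which, on elements fixed by `cyl k`, interchanges the coordinates `i` and `j` by
means of the spare coordinate `k`. -/
def swapSubst (i j k : J) (x : D) : D := subst k i (subst i j (subst j k x))

theorem cyl_swapSubst (i j k : J) (x : D) : cyl k (swapSubst i j k x) = swapSubst i j k x :=
  cyl_subst _ _ _

theorem swapSubst_mono (i j k : J) (h : x ≤ y) : swapSubst i j k x ≤ swapSubst i j k y :=
  subst_mono _ _ (subst_mono _ _ (subst_mono _ _ h))

theorem swapSubst_inf_eq_bot (hij : i ≠ j) (hjk : j ≠ k) (hki : k ≠ i) (h : x ⊓ y = ⊥) :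
    swapSubst i j k x ⊓ swapSubst i j k y = ⊥ :=
  subst_inf_eq_bot hki (subst_inf_eq_bot hij (subst_inf_eq_bot hjk h))

theorem eq_bot_of_swapSubst_eq_bot (hij : i ≠ j) (hjk : j ≠ k) (hki : k ≠ i) (hx : cyl k x = x)
    (h : swapSubst i j k x = ⊥) : x = ⊥ :=
  eq_bot_of_subst_eq_bot hjk hx (eq_bot_of_subst_eq_bot hij (cyl_subst _ _ _)
    (eq_bot_of_subst_eq_bot hki (cyl_subst _ _ _) h))

theorem swapSubst_le_self (hxi : cyl i x = x) (hxj : cyl j x = x) (hxk : cyl k x = x) :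
    swapSubst i j k x ≤ x :=
  (subst_mono _ _ ((subst_mono _ _ (subst_le_of_fixed hxj)).trans
    (subst_le_of_fixed hxi))).trans (subst_le_of_fixed hxk)

theorem swapSubst_le_of_fixed_right (hxj : cyl j x = x) (hxk : cyl k (subst i j x) = subst i j x) :
    swapSubst i j k x ≤ subst i j x :=
  (subst_mono _ _ (subst_mono _ _ (subst_le_of_fixed hxj))).trans (subst_le_of_fixed hxk)

theorem swapSubst_le_of_fixed_left (hij : i ≠ j) (hjk : j ≠ k) (hki : k ≠ i) (hxi : cyl i x = x)
    (hxk : cyl k x = x) : swapSubst i j k x ≤ subst j i x := by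
  rw [← subst_subst hjk.symm hki hij.symm hxk]
  exact subst_mono _ _ (subst_le_of_fixed (cyl_subst_of_fixed hij hki.symm hxi))

end Subst

end CylindricAlgebra

/-! ### No dense extension to a neat reduct -/

section NotDense

open Point Set

variable {n : ℕ} {K : Type u} [Nonempty K] {K₀ : Set K}

/-- The sequences whose `i`-th label is `p`. -/
def labelSet (K₀ : Set K) (p i : Fin n) : fewColours n K₀ :=
  ⟨{x | (x i).label = p}, mem_fewColours_of_boxSupported_empty
    (.of_forall_imp (finite_singleton i) finite_empty fun x y h hx => by
      rw [mem_ofPred_eq, ← h.1 i rfl]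
      exact hx)
    fun x hx y hy _ => by rw [mem_ofPred_eq, mem_ofPred_eq, hx i, hy i]⟩

theorem cyl_labelSet {p i j : Fin n} (h : j ≠ i) :
    cyl j (labelSet K₀ p i) = labelSet K₀ p i := by
  refine (le_cyl j _).antisymm' ?_
  rintro x ⟨a, ha⟩
  have ha : (Function.update x j a i).label = p := ha
  rwa [Function.update_of_ne h.symm] at ha

theorem subst_labelSet {p i j : Fin n} (h : i ≠ j) :
    subst i j (labelSet K₀ p i) = labelSet K₀ p j := by
  refine Subtype.ext (Set.ext fun x => ⟨?_, fun hx => ⟨x j, ?_, ?_⟩⟩)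
  · rintro ⟨a, h1, h2⟩
    have h1 : Function.update x i a i = Function.update x i a j := h1
    have h2 : (Function.update x i a i).label = p := h2
    rwa [h1, Function.update_of_ne h.symm] at h2
  · change Function.update x i (x j) i = Function.update x i (x j) j
    rw [Function.update_self, Function.update_of_ne h.symm]
  · change (Function.update x i (x j) i).label = p
    rwa [Function.update_self]

/-- The sequences with labels `u` and colour `k`, for a `u` other than the identity. These sets are
in the algebra for all colours `k`, not only for those in `K₀`. -/
def colourClass (K₀ : Set K) {u : Fin n → Fin n} (hu : u.Injective) (h : u ≠ id) (k : K) :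
    fewColours n K₀ :=
  ⟨{x | x ∈ box K u ∧ colour (range x) = k}, mem_fewColours_of_boxSupported_empty
    (.of_forall_imp finite_univ (finite_singleton k) fun x y hxy hx => by
      have hy : y ∈ box K u := fun i => (hxy.1 i (mem_univ i)).symm.trans (hx.1 i)
      obtain ⟨-, -, σ, hσ, hc⟩ := hxy
      have := hc univ Subset.rfl (((Finite.injective_iff_bijective.1 hu).bijOn_univ).congr
        fun i _ => (hx.1 i).symm)
      rw [image_univ, image_univ, hx.2, hσ k rfl] at this
      exact ⟨hy, this⟩)
    fun x hx y hy _ => iff_of_false (fun hx' => h (funext fun i => (hx'.1 i).symm.trans (hx i)))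
      fun hy' => h (funext fun i => (hy'.1 i).symm.trans (hy i))⟩

/-- In the neat reduct the box of a transposition would be mapped into the identity box. The images
of its uncountably many colour classes are disjoint, so by density each contains a colour from
`K₀`, a different one for each class. -/
theorem fewColours_not_mem_denseSubalgebras (hn : 1 < n) (hK : K₀.Infinite) (hc : K₀.Countable)
    [Uncountable K] :
    (⟨fewColours n K₀⟩ : CylAlg.{u} (Fin n)) ∉ DenseSubalgebras (NrSucc n) := by
  rintro ⟨C, ⟨D, ⟨e⟩⟩, f, hd⟩
  have : NeZero n := ⟨by omega⟩
  let h : fewColours n K₀ ↪[lang (Fin n)]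
    neatSubalgebra (Fin.castSuccEmb : Fin n ↪ Fin (n + 1)) D := e.toEmbedding.comp f
  have hdense : ∀ d : neatSubalgebra (Fin.castSuccEmb : Fin n ↪ Fin (n + 1)) D, d ≠ ⊥ →
      ∃ a : fewColours n K₀, a ≠ ⊥ ∧ h a ≤ d := by
    intro d hd0
    have he : e.toEmbedding (e.symm d) = d := e.apply_symm_apply d
    obtain ⟨a, ha, hle⟩ := hd (e.symm d) fun h0 => hd0 (by
      rw [← he, h0]
      exact embedding_map_bot _)
    refine ⟨a, ha, ?_⟩
    have := (embedding_le_iff e.toEmbedding).2 hle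
    rwa [he] at this
  clear_value h
  let g : fewColours n K₀ → D := fun a => (h a).1
  have gcyl : ∀ (i : Fin n) a, g (cyl i a) = cyl i.castSucc (g a) :=
    fun i a => congrArg Subtype.val (map_cyl h i a)
  have gsub : ∀ (i j : Fin n) a, g (subst i j a) = subst i.castSucc j.castSucc (g a) := by
    intro i j a
    have hdg : (h (diag i j)).1 = diag i.castSucc j.castSucc := congrArg Subtype.val (map_diag h i j)
    have hi : (h (diag i j ⊓ a)).1 = (h (diag i j)).1 ⊓ (h a).1 :=
      congrArg Subtype.val (embedding_map_inf h _ _)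
    rw [subst, gcyl, subst, ← hdg, ← hi]
  have glast : ∀ a, cyl (Fin.last n) (g a) = g a := by
    intro a
    by_contra hne
    obtain ⟨i, hi⟩ := (h a).2 _ hne
    exact (Fin.castSucc_lt_last i).ne hi
  have gle : ∀ {a b}, g a ≤ g b ↔ a ≤ b := embedding_le_iff h
  have gcylLabel : ∀ {p i j : Fin n}, j ≠ i →
      cyl j.castSucc (g (labelSet K₀ p i)) = g (labelSet K₀ p i) :=
    fun hji => by rw [← gcyl, cyl_labelSet hji]
  let i₀ : Fin n := ⟨0, by omega⟩
  let i₁ : Fin n := ⟨1, hn⟩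
  have h01 : i₀ ≠ i₁ := by simp [i₀, i₁]
  have hl : ∀ i : Fin n, Fin.last n ≠ i.castSucc := fun i => (Fin.castSucc_lt_last i).ne'
  have h01' : i₀.castSucc ≠ i₁.castSucc := (Fin.castSucc_injective n).ne h01
  let t : D → D := swapSubst i₀.castSucc i₁.castSucc (Fin.last n)
  let u : Fin n → Fin n := Equiv.swap i₀ i₁
  have hu : u.Injective := (Equiv.swap i₀ i₁).injective
  have huid : u ≠ id := fun hid => h01 (by
    have := congrFun hid i₀
    simpa [u] using this.symm)
  -- The elements `labelSet K₀ i i` have the identity box as their meet.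
  have hut : ∀ i k, t (g (colourClass K₀ hu huid k)) ≤ g (labelSet K₀ i i) := by
    intro i k
    have hle : ∀ j, g (colourClass K₀ hu huid k) ≤ g (labelSet K₀ (u j) j) :=
      fun j => gle.2 fun x hx => hx.1 j
    by_cases hi0 : i = i₀
    · subst hi0
      have h1 := hle i₁
      simp only [u, Equiv.swap_apply_right] at h1
      refine (swapSubst_mono _ _ _ h1).trans ?_
      rw [← subst_labelSet h01.symm, gsub]
      exact swapSubst_le_of_fixed_left h01' (hl _).symm (hl _) (gcylLabel h01) (glast _)
    by_cases hi1 : i = i₁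
    · subst hi1
      have h1 := hle i₀
      simp only [u, Equiv.swap_apply_left] at h1
      refine (swapSubst_mono _ _ _ h1).trans ?_
      rw [← subst_labelSet h01, gsub]
      refine swapSubst_le_of_fixed_right (gcylLabel h01.symm) ?_
      rw [← gsub, glast]
    · have h1 := hle i
      simp only [u, Equiv.swap_apply_of_ne_of_ne hi0 hi1] at h1
      exact (swapSubst_mono _ _ _ h1).trans
        (swapSubst_le_self (gcylLabel (Ne.symm hi0)) (gcylLabel (Ne.symm hi1)) (glast _))
  have hmem : ∀ k, t (g (colourClass K₀ hu huid k)) ∈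
      neatSubalgebra (Fin.castSuccEmb : Fin n ↪ Fin (n + 1)) D := by
    intro k j hj
    induction j using Fin.lastCases with
    | last => exact (hj (cyl_swapSubst _ _ _ _)).elim
    | cast j => exact ⟨j, rfl⟩
  have hne : ∀ k, t (g (colourClass K₀ hu huid k)) ≠ ⊥ := by
    intro k h0
    have h1 : g (colourClass K₀ hu huid k) = ⊥ :=
      eq_bot_of_swapSubst_eq_bot h01' (hl _).symm (hl _) (glast _) h0
    have h2 : colourClass K₀ hu huid k = ⊥ :=
      h.injective ((Subtype.ext h1).trans (embedding_map_bot h).symm)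
    obtain ⟨x, hx, hxk⟩ := exists_mem_box u k
    have : x ∈ (colourClass K₀ hu huid k).1 := ⟨hx, hxk⟩
    rw [h2] at this
    exact this
  choose a ha hat using fun k => hdense ⟨_, hmem k⟩ fun h0 => hne k (congrArg Subtype.val h0)
  have hex : ∀ k, ∃ x ∈ box K (id : Fin n → Fin n), x ∈ (a k).1 ∧ colour (range x) ∈ K₀ := by
    intro k
    obtain ⟨x, hx⟩ := nonempty_iff_ne_empty.2 fun h => ha k (Subtype.ext h)
    refine exists_mem_colour_mem hK (a k).2 (fun i => ?_) hx
    have hle : g (a k) ≤ g (labelSet K₀ i i) := le_trans (hat k) (hut i k)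
    exact gle.1 hle hx
  choose x hx hxa hxK using hex
  have hinj : (fun k => (⟨colour (range (x k)), hxK k⟩ : K₀)).Injective := by
    intro k k' hkk
    by_contra hne'
    have hmem' : x k ∈ (a k').1 := (mem_iff_of_mem_box (a k').2.1 Function.injective_id (hx k)
      (hx k') (congrArg Subtype.val hkk)).2 (hxa k')
    have hdis : colourClass K₀ hu huid k ⊓ colourClass K₀ hu huid k' = ⊥ :=
      Subtype.ext (eq_empty_of_forall_notMem fun y hy => hne' (hy.1.2.symm.trans hy.2.2))
    have hg : ∀ b c, g (b ⊓ c) = g b ⊓ g c :=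
      fun b c => congrArg Subtype.val (embedding_map_inf h b c)
    have hg0 : g ⊥ = ⊥ := congrArg Subtype.val (embedding_map_bot h)
    have h1 : g (a k ⊓ a k') ≤ g ⊥ := by
      rw [hg, hg0, ← swapSubst_inf_eq_bot h01' (hl i₁).symm (hl i₀)
        (show g (colourClass K₀ hu huid k) ⊓ g (colourClass K₀ hu huid k') = ⊥ by
          rw [← hg, hdis, hg0])]
      exact inf_le_inf (hat k) (hat k')
    exact gle.1 h1 ⟨hxa k, hmem'⟩
  have : Countable K₀ := hc.to_subtype
  exact not_countable hinj.countable

end NotDense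

theorem mainTheorem8 (n : ℕ) (hn : 2 < n) :
    (∀ K : Set (CylAlg.{u} (Fin n)),
      NrOmega n ⊆ K → K ⊆ DenseSubalgebras (NrSucc n) → ¬ IsElementaryClass K) ∧
    ∃ A B : CylAlg.{u} (Fin n),
      IsAtomic A ∧ A ∈ NrOmega n ∧ IsAtomic B ∧ (A ≅[lang (Fin n)] B) ∧
        B ∉ DenseSubalgebras (NrSucc n) := by
  have : NeZero n := ⟨by omega⟩
  let K := ULift.{u} ℝ
  let K₀ : Set K := Set.range (Infinite.natEmbedding K)
  have hK : K₀.Infinite := Set.infinite_range_of_injective (Infinite.natEmbedding K).injective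
  let A : CylAlg.{u} (Fin n) := ⟨supportedAlgebra (Fin n) (Fin n) K⟩
  let B : CylAlg.{u} (Fin n) := ⟨fewColours n K₀⟩
  have hA : A ∈ NrOmega n := supportedAlgebra_mem_nrOmega
  have hAB : A ≅[lang (Fin n)] B := fewColours_elementarilyEquivalent hK
  have hB : B ∉ DenseSubalgebras (NrSucc n) :=
    fewColours_not_mem_denseSubalgebras (by omega) hK (Set.countable_range _)
  refine ⟨fun L hL hL' ⟨T, hT⟩ => hB (hL' ((hT B).2 ?_)),
    A, B, isAtomic_supportedAlgebra, hA, isAtomic_fewColours hK, hAB, hB⟩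
  exact hAB.theory_model_iff.1 ((hT A).1 (hL hA))
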